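/- Let $\mathcal H$ be a real Hilbert space and let $F:\mathcal H\to\mathcal H$ be continuous and monotone, i.e. $\langle F(x)-F(y),x-y\rangle\ge 0$ for all $x,y\in\mathcal H$, with at least one zero. Let $p\in\{1,2,\ldots\}$ and let $x_0\in\mathcal H$ satisfy $F(x_0)\neq 0$. Let $(x,v,s):[0,+\infty)\to\mathcal H\times\mathcal H\times\mathcal H$ be a global solution of the rescaled gradient dynamical system, that is, $s$ is differentiable on $[0,+\infty)$ (one-sidedly at $0$), $s(0)=0$, and for all $t\ge 0$ $$\dot s(t)=-\frac{F(x(t))}{\|F(x(t))\|^{1-1/p}},\qquad v(t)=x_0+s(t),\qquad x(t)-v(t)+\frac{F(x(t))}{\|F(x(t))\|^{1-1/p}}=0,$$ where the quotient is read as $F(x(t))$ if $p=1$ and as $0$ if $F(x(t))=0$. Then there exists $\bar x\in\mathcal H$ with $F(\bar x)=0$ such that $x(t)$ and $v(t)$ both converge weakly to $\bar x$ as $t\to+\infty$. Moreover, $x(t)$ and $v(t)$ both converge to $\bar x$ strongly (in norm) if at least one of the following conditions holds: 1. $F=\nabla f$ for some convex, differentiable function $f:\mathcal H\to\mathbb R$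 that is inf-compact, i.e. all sublevel sets $\{z\in\mathcal H: f(z)\le c\}$, $c\in\mathbb R$, are compact; 2. the zero set $\{z\in\mathcal H: F(z)=0\}$ has nonempty interior. -/

import Mathlib

open Filter Topology

/-- `F : H → H` is monotone: `⟪F x - F y, x - y⟫ ≥ 0` for all `x`, `y`. -/
def IsMonotoneOperator {H : Type*} [NormedAddCommGroup H] [InnerProductSpace ℝ H]
    (F : H → H) : Prop :=
  ∀ x y : H, 0 ≤ inner ℝ (F x - F y) (x - y)

/-- The rescaled field `F z / ‖F z‖ ^ (1 - 1/p)`. For `p = 1` the denominator is `1`, so this is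
`F z`. At a zero of `F` its value is `0`, which is also its limit there when `F` is continuous. -/
noncomputable def rescaledField {H : Type*} [NormedAddCommGroup H] [InnerProductSpace ℝ H]
    (F : H → H) (p : ℕ) (z : H) : H :=
  (‖F z‖ ^ (1 - 1 / (p : ℝ)))⁻¹ • F z

/-- `(x, v, s)` is a global (classical) solution on `[0, +∞)` of the rescaled gradient dynamical
system of order `p` with starting point `x₀`, which is not a zero of `F`. The functions are defined
on `ℝ`, but only their values on `[0, +∞)` matter; at `t = 0` the derivative is one-sided.
The initial condition `s 0 = 0` says that `v 0 = x₀`. (The value `x 0` is then determined by the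
third equation, and it is never `x₀`.) -/
structure IsGlobalSolution {H : Type*} [NormedAddCommGroup H] [InnerProductSpace ℝ H]
    (F : H → H) (p : ℕ) (x₀ : H) (x v s : ℝ → H) : Prop where
  start_ne : F x₀ ≠ 0
  s_zero : s 0 = 0
  deriv_s : ∀ t : ℝ, 0 ≤ t →
    HasDerivWithinAt s (-rescaledField F p (x t)) (Set.Ici 0) t
  v_eq : ∀ t : ℝ, 0 ≤ t → v t = x₀ + s t
  x_eq : ∀ t : ℝ, 0 ≤ t → x t - v t + rescaledField F p (x t) = 0

/-- A real-valued function is inf-compact if all its sublevel sets are (norm-)compact. -/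
def IsInfCompact {H : Type*} [TopologicalSpace H] (f : H → ℝ) : Prop :=
  ∀ c : ℝ, IsCompact {z : H | f z ≤ c}

/-- `u t` converges weakly to `a` as `t → +∞`. -/
def WeaklyConvergesTo {H : Type*} [NormedAddCommGroup H] [InnerProductSpace ℝ H]
    (u : ℝ → H) (a : H) : Prop :=
  Tendsto (fun t => toWeakSpace ℝ H (u t)) atTop (𝓝 (toWeakSpace ℝ H a))

/-! Write `G(t)` for the rescaled field at `x(t)`, so that `v' = -G` and `v = x + G`. For a zero `z`
of `F`, monotonicity gives `⟪v - z, G⟫ ≥ ‖G‖²`, hence `‖v - z‖²` has derivative at most `-2‖G‖²`: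
the distance from `v` to every zero is nonincreasing and converges.

Moreover `F x = ‖G‖ ^ (p - 1) • G`, and monotonicity of `F` together with a coercivity bound for
this power map makes `G` a Lipschitz function of `v`, so of `t`. A Lipschitz `G` that stayed large
would make `‖v - z‖²` drop by a fixed amount infinitely often, so `G → 0`. Then `F x → 0` and `x - v
→ 0`; weak cluster points of `v` are zeros by Minty's trick, and Opial's lemma gives the weak limit.

Strong convergence: in the gradient case the gradient inequality traps `x` in a compact sublevel
set; if a ball consists of zeros, the decrease of `‖v - z‖²` bounds the increments of `v`, so `v` is
Cauchy. -/

/-! ### Weak convergence and Opial's lemma. -/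

section WeakTopology

variable {H : Type*} [NormedAddCommGroup H] [InnerProductSpace ℝ H] {ι : Type*} {l : Filter ι}

/-- In a Hilbert space, weak convergence can be tested on inner products. -/
lemma tendsto_toWeakSpace_of_tendsto_inner [CompleteSpace H] {u : ι → H} {a : H}
    (h : ∀ y, Tendsto (fun i => inner ℝ (u i) y) l (𝓝 (inner ℝ a y))) :
    Tendsto (fun i => toWeakSpace ℝ H (u i)) l (𝓝 (toWeakSpace ℝ H a)) := by
  have hinj : Function.Injective (topDualPairing ℝ H).flip := by
    intro b c hbc
    refine ext_inner_left ℝ fun y => ?_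
    exact LinearMap.congr_fun hbc (InnerProductSpace.toDual ℝ H y)
  refine (WeakBilin.tendsto_iff_forall_eval_tendsto _ hinj).2 fun φ => ?_
  have key : ∀ w : H, (topDualPairing ℝ H).flip w φ
      = inner ℝ w ((InnerProductSpace.toDual ℝ H).symm φ) := by
    intro w
    rw [real_inner_comm, InnerProductSpace.toDual_symm_apply]
    rfl
  have := h ((InnerProductSpace.toDual ℝ H).symm φ)
  simp only [← key] at this
  exact this

/-- Banach–Alaoglu for ultrafilters in a Hilbert space. -/
lemma exists_forall_tendsto_inner_of_norm_le [CompleteSpace H] (U : Ultrafilter ι) {u : ι → H}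
    {R : ℝ} (h : ∀ᶠ i in (U : Filter ι), ‖u i‖ ≤ R) :
    ∃ w : H, ∀ y, Tendsto (fun i => inner ℝ (u i) y) U (𝓝 (inner ℝ w y)) := by
  let D : ι → WeakDual ℝ H := fun i =>
    StrongDual.toWeakDual (InnerProductSpace.toDual ℝ H (u i))
  have hcomp := WeakDual.isCompact_closedBall (𝕜 := ℝ) (E := H) 0 R
  have hmem : (U.map D : Filter (WeakDual ℝ H)) ≤
      𝓟 (WeakDual.toStrongDual ⁻¹' Metric.closedBall (0 : StrongDual ℝ H) R) := by
    rw [le_principal_iff, Ultrafilter.coe_map, mem_map]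
    filter_upwards [h] with i hi
    have : ‖InnerProductSpace.toDual ℝ H (u i)‖ ≤ R := by simpa using hi
    simpa [D] using this
  obtain ⟨φ, -, hφ⟩ := hcomp.ultrafilter_le_nhds _ hmem
  refine ⟨(InnerProductSpace.toDual ℝ H).symm (WeakDual.toStrongDual φ), fun y => ?_⟩
  rw [InnerProductSpace.toDual_symm_apply]
  have h1 : Tendsto D U (𝓝 φ) := hφ
  exact ((WeakDual.eval_continuous y).tendsto φ).comp h1

/-- **Opial's lemma**. -/
lemma exists_forall_tendsto_inner_of_opial [CompleteSpace H] [l.NeBot] {u : ι → H} {S : Set H}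
    (hS : S.Nonempty) (hnorm : ∀ z ∈ S, ∃ c, Tendsto (fun i => ‖u i - z‖) l (𝓝 c))
    (hcluster : ∀ U : Ultrafilter ι, (U : Filter ι) ≤ l → ∀ w,
      (∀ y, Tendsto (fun i => inner ℝ (u i) y) U (𝓝 (inner ℝ w y))) → w ∈ S) :
    ∃ w ∈ S, ∀ y, Tendsto (fun i => inner ℝ (u i) y) l (𝓝 (inner ℝ w y)) := by
  obtain ⟨z, hz⟩ := hS
  obtain ⟨c, hc⟩ := hnorm z hz
  have hbdd : ∀ᶠ i in l, ‖u i‖ ≤ c + 1 + ‖z‖ := by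
    filter_upwards [hc.eventually_le_const (lt_add_one c)] with i hi
    calc ‖u i‖ = ‖(u i - z) + z‖ := by rw [sub_add_cancel]
      _ ≤ ‖u i - z‖ + ‖z‖ := norm_add_le _ _
      _ ≤ _ := by linarith
  have hex : ∀ U : Ultrafilter ι, (U : Filter ι) ≤ l →
      ∃ w ∈ S, ∀ y, Tendsto (fun i => inner ℝ (u i) y) U (𝓝 (inner ℝ w y)) := by
    intro U hU
    obtain ⟨w, hw⟩ := exists_forall_tendsto_inner_of_norm_le U (hU hbdd)
    exact ⟨w, hcluster U hU w hw, hw⟩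
  obtain ⟨w, hwS, hw⟩ := hex (Ultrafilter.of l) (Ultrafilter.of_le l)
  refine ⟨w, hwS, fun y => tendsto_iff_ultrafilter _ _ _ |>.2 fun U hU => ?_⟩
  obtain ⟨w', hwS', hw'⟩ := hex U hU
  suffices w' = w by rw [← this]; exact hw' y
  obtain ⟨c₁, hc₁⟩ := hnorm w hwS
  obtain ⟨c₂, hc₂⟩ := hnorm w' hwS'
  -- The difference `‖u - w‖² - ‖u - w'‖²` is affine in `u`, so the pairing with `w' - w` converges
  -- along all of `l`. Both cluster points then pair equally with `w' - w`.
  have hlim : Tendsto (fun i => inner ℝ (u i) (w' - w)) l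
      (𝓝 ((c₁ ^ 2 - c₂ ^ 2 + (‖w'‖ ^ 2 - ‖w‖ ^ 2)) / 2)) := by
    refine ((((hc₁.pow 2).sub (hc₂.pow 2)).add_const (‖w'‖ ^ 2 - ‖w‖ ^ 2)).div_const 2).congr
      fun i => ?_
    rw [norm_sub_sq_real, norm_sub_sq_real, inner_sub_right]
    ring
  have e₁ := tendsto_nhds_unique (hw (w' - w)) (hlim.mono_left (Ultrafilter.of_le l))
  have e₂ := tendsto_nhds_unique (hw' (w' - w)) (hlim.mono_left hU)
  have : inner ℝ (w' - w) (w' - w) = 0 := by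
    rw [inner_sub_left, e₁, e₂, sub_self]
  exact sub_eq_zero.1 (inner_self_eq_zero.1 this)

/-- Weak convergence upgrades to strong convergence inside a compact set. -/
lemma tendsto_of_tendsto_inner_of_isCompact {u : ι → H} {a : H} {K : Set H} (hK : IsCompact K)
    (hu : ∀ᶠ i in l, u i ∈ K)
    (h : ∀ y, Tendsto (fun i => inner ℝ (u i) y) l (𝓝 (inner ℝ a y))) : Tendsto u l (𝓝 a) := by
  refine tendsto_iff_ultrafilter _ _ _ |>.2 fun U hU => ?_
  have hmem : (U.map u : Filter H) ≤ 𝓟 K := by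
    rw [le_principal_iff, Ultrafilter.coe_map, mem_map]
    exact hU hu
  obtain ⟨b, -, hb⟩ := hK.ultrafilter_le_nhds _ hmem
  have hb' : Tendsto u U (𝓝 b) := hb
  suffices b = a by rw [← this]; exact hb'
  refine ext_inner_right ℝ fun y => ?_
  exact tendsto_nhds_unique (hb'.inner tendsto_const_nhds) ((h y).mono_left hU)

lemma eq_of_tendsto_of_tendsto_inner [l.NeBot] {u : ι → H} {a b : H} (hb : Tendsto u l (𝓝 b))
    (h : ∀ y, Tendsto (fun i => inner ℝ (u i) y) l (𝓝 (inner ℝ a y))) : b = a :=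
  ext_inner_right ℝ fun y => tendsto_nhds_unique (hb.inner tendsto_const_nhds) (h y)

end WeakTopology

/-! ### Monotone operators and the power map `a ↦ ‖a‖ ^ n • a`. -/

section MonotoneOperators

variable {H : Type*} [NormedAddCommGroup H] [InnerProductSpace ℝ H]

/-- **Minty's trick**. -/
lemma eq_zero_of_forall_inner_nonneg {F : H → H} (hF : Continuous F) {w : H}
    (h : ∀ y, 0 ≤ inner ℝ (F y) (y - w)) : F w = 0 := by
  -- Test the hypothesis at `y = w - ε F w`, divide by `ε`, and let `ε → 0`: the limit is `-‖F w‖²`.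
  have hlim : Tendsto (fun ε : ℝ => inner ℝ (F (w + ε • (-F w))) (-F w)) (𝓝[>] 0)
      (𝓝 (inner ℝ (F (w + (0 : ℝ) • (-F w))) (-F w))) := by
    refine Tendsto.mono_left (Continuous.tendsto ?_ 0) nhdsWithin_le_nhds
    fun_prop
  have hnn : 0 ≤ inner ℝ (F (w + (0 : ℝ) • (-F w))) (-F w) := by
    refine ge_of_tendsto hlim ?_
    filter_upwards [self_mem_nhdsWithin] with ε hε
    have := h (w + ε • (-F w))
    rw [add_sub_cancel_left, real_inner_smul_right] at this
    exact nonneg_of_mul_nonneg_right this hε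
  rw [zero_smul, add_zero, inner_neg_right, real_inner_self_eq_norm_sq] at hnn
  have : ‖F w‖ ^ 2 = 0 := le_antisymm (by linarith) (sq_nonneg _)
  simpa using this

/-- Demiclosedness of a continuous monotone operator at zero. -/
lemma IsMonotoneOperator.eq_zero_of_tendsto {ι : Type*} {l : Filter ι} [l.NeBot] {F : H → H}
    (hmono : IsMonotoneOperator F) (hF : Continuous F) {u : ι → H} {w : H} {R : ℝ}
    (hbdd : ∀ᶠ i in l, ‖u i‖ ≤ R) (hzero : Tendsto (fun i => F (u i)) l (𝓝 0))
    (hu : ∀ y, Tendsto (fun i => inner ℝ (u i) y) l (𝓝 (inner ℝ w y))) : F w = 0 := by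
  refine eq_zero_of_forall_inner_nonneg hF fun y => ?_
  have h1 : Tendsto (fun i => inner ℝ (F (u i)) (u i - y)) l (𝓝 0) := by
    refine squeeze_zero_norm' (a := fun i => ‖F (u i)‖ * (R + ‖y‖)) ?_ ?_
    · filter_upwards [hbdd] with i hi
      refine (norm_inner_le_norm _ _).trans ?_
      gcongr
      exact (norm_sub_le _ _).trans (by linarith)
    · simpa using hzero.norm.mul_const (R + ‖y‖)
  have h2 : Tendsto (fun i => inner ℝ (F y) (u i - y)) l (𝓝 (inner ℝ (F y) (w - y))) := by
    simp only [real_inner_comm _ (F y), inner_sub_left]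
    exact (hu (F y)).sub_const _
  have h3 := ge_of_tendsto (h1.sub h2) (Eventually.of_forall fun i => by
    have := hmono (u i) y
    rwa [inner_sub_left] at this)
  rw [zero_sub, ← inner_neg_right, neg_sub] at h3
  exact h3

lemma pow_sub_pow_mul_add_le {r q : ℝ} (hq : 0 ≤ q) (hqr : q ≤ r) (n : ℕ) :
    (r ^ n - q ^ n) * (r + q) ≤ 2 * n * r ^ n * (r - q) := by
  have hr := hq.trans hqr
  rcases n with _ | n
  · simp
  have h := abs_pow_sub_pow_le r q (n + 1)
  rw [abs_of_nonneg (sub_nonneg.2 hqr), abs_of_nonneg hr, abs_of_nonneg hq, max_eq_left hqr,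
    Nat.add_sub_cancel] at h
  have h1 : r ^ (n + 1) - q ^ (n + 1) ≤ (r - q) * ((n + 1 : ℕ) : ℝ) * r ^ n :=
    (le_abs_self _).trans h
  have h2 : 0 ≤ (r - q) * ((n + 1 : ℕ) : ℝ) * r ^ n :=
    mul_nonneg (mul_nonneg (sub_nonneg.2 hqr) (Nat.cast_nonneg _)) (pow_nonneg hr _)
  calc (r ^ (n + 1) - q ^ (n + 1)) * (r + q)
      ≤ ((r - q) * ((n + 1 : ℕ) : ℝ) * r ^ n) * (r + r) := by gcongr
    _ = _ := by ring

lemma norm_powerMap_sub_le (n : ℕ) (a b : H) :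
    ‖‖a‖ ^ n • a - ‖b‖ ^ n • b‖ ≤ (‖a‖ ^ n + ‖b‖ ^ n) * (2 * n + 1 / 2) * ‖a - b‖ := by
  wlog hab : ‖b‖ ≤ ‖a‖ generalizing a b
  · have := this b a (le_of_not_ge hab)
    rwa [norm_sub_rev, norm_sub_rev b a, add_comm (‖b‖ ^ n)] at this
  have hpow : ‖b‖ ^ n ≤ ‖a‖ ^ n := by gcongr
  have hid : ‖a‖ ^ n • a - ‖b‖ ^ n • b = ((‖a‖ ^ n + ‖b‖ ^ n) / 2) • (a - b)
      + ((‖a‖ ^ n - ‖b‖ ^ n) / 2) • (a + b) := by module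
  have h1 := pow_sub_pow_mul_add_le (norm_nonneg b) hab n
  have h2 : ‖a‖ - ‖b‖ ≤ ‖a - b‖ := norm_sub_norm_le a b
  have hb : 0 ≤ ‖b‖ ^ n := by positivity
  calc ‖‖a‖ ^ n • a - ‖b‖ ^ n • b‖
      ≤ (‖a‖ ^ n + ‖b‖ ^ n) / 2 * ‖a - b‖ + (‖a‖ ^ n - ‖b‖ ^ n) / 2 * ‖a + b‖ := by
        rw [hid]
        refine (norm_add_le _ _).trans_eq ?_
        rw [norm_smul, norm_smul, Real.norm_of_nonneg (by positivity),
          Real.norm_of_nonneg (by linarith)]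
    _ ≤ (‖a‖ ^ n + ‖b‖ ^ n) / 2 * ‖a - b‖ + (‖a‖ ^ n - ‖b‖ ^ n) / 2 * (‖a‖ + ‖b‖) := by
        have : 0 ≤ (‖a‖ ^ n - ‖b‖ ^ n) / 2 := by linarith
        gcongr
        exact norm_add_le a b
    _ ≤ (‖a‖ ^ n + ‖b‖ ^ n) / 2 * ‖a - b‖ + n * ‖a‖ ^ n * (‖a‖ - ‖b‖) := by linarith
    _ ≤ (‖a‖ ^ n + ‖b‖ ^ n) / 2 * ‖a - b‖ + 2 * n * (‖a‖ ^ n + ‖b‖ ^ n) * ‖a - b‖ := by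
        have hn : (0 : ℝ) ≤ n * ‖a‖ ^ n := by positivity
        have hn' : (0 : ℝ) ≤ n * ‖b‖ ^ n := by positivity
        have h0 := norm_nonneg (a - b)
        have := mul_le_mul_of_nonneg_left h2 hn
        have := mul_nonneg hn h0
        have := mul_nonneg hn' h0
        linarith
    _ = _ := by ring

/-- The inner product exceeds the left side by half the product of `‖a‖ ^ n - ‖b‖ ^ n` and `‖a‖² -
‖b‖²`, which never have opposite signs. The weight matches the one in `norm_powerMap_sub_le`, so it
cancels in the Lipschitz estimate. -/
lemma le_inner_powerMap_sub (n : ℕ) (a b : H) :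
    (‖a‖ ^ n + ‖b‖ ^ n) / 2 * ‖a - b‖ ^ 2 ≤ inner ℝ (‖a‖ ^ n • a - ‖b‖ ^ n • b) (a - b) := by
  have hid : inner ℝ (‖a‖ ^ n • a - ‖b‖ ^ n • b) (a - b)
      = (‖a‖ ^ n + ‖b‖ ^ n) / 2 * ‖a - b‖ ^ 2
        + (‖a‖ ^ n - ‖b‖ ^ n) / 2 * (‖a‖ ^ 2 - ‖b‖ ^ 2) := by
    rw [norm_sub_sq_real]
    simp only [inner_sub_left, inner_sub_right, real_inner_smul_left, real_inner_self_eq_norm_sq,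
      real_inner_comm a b]
    ring
  rw [hid]
  have : 0 ≤ (‖a‖ ^ n - ‖b‖ ^ n) / 2 * (‖a‖ ^ 2 - ‖b‖ ^ 2) := by
    rcases le_total ‖b‖ ‖a‖ with h | h
    · refine mul_nonneg (div_nonneg (sub_nonneg.2 ?_) two_pos.le) (sub_nonneg.2 ?_) <;> gcongr
    · refine mul_nonneg_of_nonpos_of_nonpos
        (div_nonpos_of_nonpos_of_nonneg (sub_nonpos.2 ?_) two_pos.le) (sub_nonpos.2 ?_) <;> gcongr
  linarith

/-- The resolvent-type map `x + a ↦ a`, where `‖a‖ ^ n • a` depends monotonically on `x`, is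
Lipschitz: here `d` is the increment of `x + a`. -/
lemma norm_sub_le_of_inner_powerMap_nonneg (n : ℕ) {a b d : H}
    (h : 0 ≤ inner ℝ (‖a‖ ^ n • a - ‖b‖ ^ n • b) (d - (a - b))) :
    ‖a - b‖ ≤ (4 * n + 1) * ‖d‖ := by
  rcases (norm_nonneg (a - b)).eq_or_lt with h0 | h0
  · rw [← h0]; positivity
  have hσ : 0 < ‖a‖ ^ n + ‖b‖ ^ n := by
    rcases eq_or_ne a 0 with rfl | ha
    · have : b ≠ 0 := by rintro rfl; simp at h0
      have := norm_pos_iff.2 this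
      positivity
    · have := norm_pos_iff.2 ha
      positivity
  rw [inner_sub_right, sub_nonneg] at h
  have h1 := (le_inner_powerMap_sub n a b).trans (h.trans (real_inner_le_norm _ _))
  have h2 := h1.trans (mul_le_mul_of_nonneg_right (norm_powerMap_sub_le n a b) (norm_nonneg d))
  -- Cancelling half the weight turns `2n + 1/2` into `4n + 1`.
  refine le_of_mul_le_mul_left ?_ (mul_pos (half_pos hσ) h0)
  calc _ = (‖a‖ ^ n + ‖b‖ ^ n) / 2 * ‖a - b‖ ^ 2 := by ring
    _ ≤ _ := h2
    _ = _ := by ring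

lemma norm_rescaledField {F : H → H} {p : ℕ} (hp : 1 ≤ p) (z : H) :
    ‖rescaledField F p z‖ = ‖F z‖ ^ (1 / (p : ℝ)) := by
  have hp' : (p : ℝ) ≠ 0 := by positivity
  rcases (norm_nonneg (F z)).eq_or_lt with h | h
  · have h0 : F z = 0 := norm_eq_zero.1 h.symm
    simp [rescaledField, h0, Real.zero_rpow (inv_ne_zero hp')]
  · rw [rescaledField, norm_smul, norm_inv, Real.norm_of_nonneg (by positivity),
      ← Real.rpow_neg h.le]
    nth_rewrite 2 [← Real.rpow_one ‖F z‖]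
    rw [← Real.rpow_add h]
    congr 1
    ring

/-- Inverts the rescaling, leaving only a natural exponent, so the power map estimates apply with `n
= p - 1`. -/
lemma norm_pow_smul_rescaledField {F : H → H} {p : ℕ} (hp : 1 ≤ p) (z : H) :
    ‖rescaledField F p z‖ ^ (p - 1) • rescaledField F p z = F z := by
  have hp' : (p : ℝ) ≠ 0 := by positivity
  rcases eq_or_ne (F z) 0 with h0 | h0
  · simp [rescaledField, h0]
  have h : 0 < ‖F z‖ := norm_pos_iff.2 h0
  have : ‖rescaledField F p z‖ ^ (p - 1) = ‖F z‖ ^ (1 - 1 / (p : ℝ)) := by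
    rw [norm_rescaledField hp, ← Real.rpow_natCast, ← Real.rpow_mul h.le, Nat.cast_sub hp]
    congr 1
    field_simp
    simp
  rw [this, rescaledField, smul_smul, mul_inv_cancel₀ (by positivity), one_smul]

end MonotoneOperators

/-- The gradient inequality for a differentiable convex function. -/
lemma ConvexOn.le_add_inner_gradient {H : Type*} [NormedAddCommGroup H] [InnerProductSpace ℝ H]
    [CompleteSpace H] {f : H → ℝ} (hf : ConvexOn ℝ Set.univ f) (hd : Differentiable ℝ f)
    (a b : H) : f a ≤ f b + inner ℝ (gradient f a) (a - b) := by
  have hconv : ConvexOn ℝ Set.univ (f ∘ AffineMap.lineMap (k := ℝ) a b) := by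
    simpa using hf.comp_affineMap (AffineMap.lineMap (k := ℝ) a b)
  have hder : HasDerivAt (f ∘ AffineMap.lineMap (k := ℝ) a b)
      (inner ℝ (gradient f a) (b - a)) 0 := by
    have h1 : HasDerivAt (AffineMap.lineMap (k := ℝ) a b) (b - a) (0 : ℝ) :=
      AffineMap.hasDerivAt_lineMap
    have h2 : HasFDerivAt f (InnerProductSpace.toDual ℝ H (gradient f a))
        (AffineMap.lineMap (k := ℝ) a b (0 : ℝ)) := by
      rw [AffineMap.lineMap_apply_zero]
      exact (hd a).hasGradientAt.hasFDerivAt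
    simpa using h2.comp_hasDerivAt (0 : ℝ) h1
  have h := hconv.le_slope_of_hasDerivAt (Set.mem_univ 0) (Set.mem_univ 1) zero_lt_one hder
  have hs : slope (f ∘ AffineMap.lineMap (k := ℝ) a b) 0 1 = f b - f a := by
    simp [slope_def_field]
  rw [hs] at h
  rw [← neg_sub b a, inner_neg_right]
  linarith

/-! ### Energy estimates along a trajectory. -/

namespace IsGlobalSolution

variable {H : Type*} [NormedAddCommGroup H] [InnerProductSpace ℝ H] {F : H → H} {p : ℕ} {x₀ : H}
  {x v s : ℝ → H}

lemma v_eq_add (hsol : IsGlobalSolution F p x₀ x v s) {t : ℝ} (ht : 0 ≤ t) :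
    v t = x t + rescaledField F p (x t) := by
  have := hsol.x_eq t ht
  rw [sub_add_eq_add_sub, sub_eq_zero] at this
  exact this.symm

lemma hasDerivWithinAt_v (hsol : IsGlobalSolution F p x₀ x v s) {t : ℝ} (ht : 0 ≤ t) :
    HasDerivWithinAt v (-rescaledField F p (x t)) (Set.Ici 0) t :=
  ((hsol.deriv_s t ht).const_add x₀).congr (fun r hr => hsol.v_eq r hr) (hsol.v_eq t ht)

lemma hasDerivWithinAt_normSq (hsol : IsGlobalSolution F p x₀ x v s) (z : H) {t : ℝ}
    (ht : 0 ≤ t) : HasDerivWithinAt (fun r => ‖v r - z‖ ^ 2)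
      (2 * inner ℝ (v t - z) (-rescaledField F p (x t))) (Set.Ici 0) t :=
  ((hsol.hasDerivWithinAt_v ht).sub_const z).norm_sq

lemma inner_le_neg_normSq (hF : IsMonotoneOperator F) (hsol : IsGlobalSolution F p x₀ x v s)
    {z : H} (hz : F z = 0) {t : ℝ} (ht : 0 ≤ t) :
    inner ℝ (v t - z) (-rescaledField F p (x t)) ≤ -‖rescaledField F p (x t)‖ ^ 2 := by
  have h := hF (x t) z
  rw [hz, sub_zero] at h
  have h' : 0 ≤ inner ℝ (x t - z) (rescaledField F p (x t)) := by
    rw [rescaledField, real_inner_smul_right, real_inner_comm]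
    exact mul_nonneg (by positivity) h
  have e : v t - z = (x t - z) + rescaledField F p (x t) := by
    rw [hsol.v_eq_add ht]; abel
  rw [e, inner_neg_right, inner_add_left, real_inner_self_eq_norm_sq]
  linarith

/-- Integrated form of the energy inequality; `c = 0` gives Fejér monotonicity, positive `c` a
quantitative drop. -/
lemma normSq_add_le (hF : IsMonotoneOperator F) (hsol : IsGlobalSolution F p x₀ x v s)
    {z : H} (hz : F z = 0) {c t₁ t₂ : ℝ} (h₁ : 0 ≤ t₁) (h₁₂ : t₁ ≤ t₂)
    (hc : ∀ t ∈ Set.Icc t₁ t₂, c ≤ ‖rescaledField F p (x t)‖ ^ 2) :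
    ‖v t₂ - z‖ ^ 2 + 2 * c * (t₂ - t₁) ≤ ‖v t₁ - z‖ ^ 2 := by
  have hsub : Set.Icc t₁ t₂ ⊆ Set.Ici 0 := fun t ht => h₁.trans ht.1
  have hd : ∀ t ∈ Set.Icc t₁ t₂, HasDerivWithinAt (fun r => ‖v r - z‖ ^ 2 + 2 * c * r)
      (2 * inner ℝ (v t - z) (-rescaledField F p (x t)) + 2 * c) (Set.Icc t₁ t₂) t := by
    intro t ht
    have h := ((hsol.hasDerivWithinAt_normSq z (hsub ht)).mono hsub).add
      ((hasDerivWithinAt_id t (Set.Icc t₁ t₂)).const_mul (2 * c))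
    rw [mul_one] at h
    exact h
  have hanti : AntitoneOn (fun r => ‖v r - z‖ ^ 2 + 2 * c * r) (Set.Icc t₁ t₂) := by
    refine antitoneOn_of_hasDerivWithinAt_nonpos (convex_Icc _ _)
      (fun t ht => (hd t ht).continuousWithinAt)
      (fun t ht => (hd t (interior_subset ht)).mono interior_subset) fun t ht => ?_
    have ht' := interior_subset ht
    have := hsol.inner_le_neg_normSq hF hz (hsub ht')
    have := hc t ht'
    linarith
  have := hanti (Set.left_mem_Icc.2 h₁₂) (Set.right_mem_Icc.2 h₁₂) h₁₂
  simp only at this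
  linarith

lemma normSq_le (hF : IsMonotoneOperator F) (hsol : IsGlobalSolution F p x₀ x v s)
    {z : H} (hz : F z = 0) {t₁ t₂ : ℝ} (h₁ : 0 ≤ t₁) (h₁₂ : t₁ ≤ t₂) :
    ‖v t₂ - z‖ ^ 2 ≤ ‖v t₁ - z‖ ^ 2 := by
  simpa using hsol.normSq_add_le hF hz (c := 0) h₁ h₁₂ fun t _ => sq_nonneg _

lemma norm_le (hF : IsMonotoneOperator F) (hsol : IsGlobalSolution F p x₀ x v s)
    {z : H} (hz : F z = 0) {t₁ t₂ : ℝ} (h₁ : 0 ≤ t₁) (h₁₂ : t₁ ≤ t₂) :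
    ‖v t₂ - z‖ ≤ ‖v t₁ - z‖ :=
  le_of_sq_le_sq (hsol.normSq_le hF hz h₁ h₁₂) (norm_nonneg _)

lemma exists_tendsto_norm (hF : IsMonotoneOperator F) (hsol : IsGlobalSolution F p x₀ x v s)
    {z : H} (hz : F z = 0) : ∃ c, Tendsto (fun t => ‖v t - z‖) atTop (𝓝 c) := by
  -- Clamping at `0` extends the monotonicity from `[0, ∞)` to all of `ℝ`.
  have hanti : Antitone fun t : ℝ => ‖v (max t 0) - z‖ := fun a b hab =>
    hsol.norm_le hF hz (le_max_right a 0) (max_le_max_right 0 hab)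
  refine ⟨_, (tendsto_atTop_ciInf hanti ⟨0, ?_⟩).congr' ?_⟩
  · rintro _ ⟨t, rfl⟩
    exact norm_nonneg _
  · filter_upwards [eventually_ge_atTop 0] with t ht
    rw [max_eq_left ht]

lemma norm_rescaledField_le (hF : IsMonotoneOperator F) (hsol : IsGlobalSolution F p x₀ x v s)
    {z : H} (hz : F z = 0) {t : ℝ} (ht : 0 ≤ t) :
    ‖rescaledField F p (x t)‖ ≤ ‖v 0 - z‖ := by
  refine le_trans ?_ (hsol.norm_le hF hz le_rfl ht)
  have h := hsol.inner_le_neg_normSq hF hz ht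
  rw [inner_neg_right, neg_le_neg_iff] at h
  have h' := h.trans (real_inner_le_norm _ _)
  rcases (norm_nonneg (rescaledField F p (x t))).eq_or_lt with h0 | h0
  · rw [← h0]; exact norm_nonneg _
  · rw [pow_two] at h'
    exact le_of_mul_le_mul_right h' h0

lemma norm_v_sub_le (hF : IsMonotoneOperator F) (hsol : IsGlobalSolution F p x₀ x v s)
    {z : H} (hz : F z = 0) {t₁ t₂ : ℝ} (h₁ : 0 ≤ t₁) (h₂ : 0 ≤ t₂) :
    ‖v t₂ - v t₁‖ ≤ ‖v 0 - z‖ * |t₂ - t₁| :=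
  (convex_Ici 0).norm_image_sub_le_of_norm_hasDerivWithin_le
    (fun _ ht => hsol.hasDerivWithinAt_v ht)
    (fun t ht => by rw [norm_neg]; exact hsol.norm_rescaledField_le hF hz ht) h₁ h₂

lemma norm_rescaledField_sub_le (hF : IsMonotoneOperator F) (hp : 1 ≤ p)
    (hsol : IsGlobalSolution F p x₀ x v s) {t₁ t₂ : ℝ} (h₁ : 0 ≤ t₁) (h₂ : 0 ≤ t₂) :
    ‖rescaledField F p (x t₂) - rescaledField F p (x t₁)‖
      ≤ (4 * (p - 1 : ℕ) + 1) * ‖v t₂ - v t₁‖ := by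
  refine norm_sub_le_of_inner_powerMap_nonneg (p - 1) ?_
  rw [norm_pow_smul_rescaledField hp, norm_pow_smul_rescaledField hp, hsol.v_eq_add h₁,
    hsol.v_eq_add h₂]
  convert hF (x t₂) (x t₁) using 2
  abel

lemma tendsto_rescaledField (hF : IsMonotoneOperator F) (hp : 1 ≤ p)
    (hsol : IsGlobalSolution F p x₀ x v s) {z : H} (hz : F z = 0) :
    Tendsto (fun t => rescaledField F p (x t)) atTop (𝓝 0) := by
  -- A Lipschitz constant of the field in time; the `+ 1` makes it positive, and `δ` below is chosen
  -- so that `L * δ = ε / 2`.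
  set L : ℝ := (4 * (p - 1 : ℕ) + 1) * ‖v 0 - z‖ + 1 with hL
  have hL0 : 0 < L := by positivity
  obtain ⟨c, hc⟩ := hsol.exists_tendsto_norm hF hz
  rw [Metric.tendsto_nhds]
  intro ε hε
  set δ : ℝ := ε / (2 * L) with hδ
  have hδ0 : 0 < δ := by positivity
  have hshift : Tendsto (fun t : ℝ => ‖v t - z‖ ^ 2 - ‖v (t + δ) - z‖ ^ 2) atTop (𝓝 0) := by
    have h1 := (hc.pow 2).sub
      (((hc.comp (tendsto_atTop_add_const_right atTop δ tendsto_id))).pow 2)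
    rw [sub_self] at h1
    exact h1
  have hpos : 0 < 2 * (ε / 2) ^ 2 * δ := by positivity
  filter_upwards [eventually_ge_atTop 0, hshift.eventually_lt_const hpos] with t ht hlt
  rw [dist_zero_right]
  -- Norm at least `ε` at `t` forces norm at least `ε / 2` on `[t, t + δ]`, hence a drop of at least
  -- `2 (ε / 2)² δ`, contradicting `hlt`.
  by_contra! hge
  have := hsol.normSq_add_le hF hz (c := (ε / 2) ^ 2) ht (le_add_of_nonneg_right hδ0.le)
    fun r hr => by
      have hr0 : 0 ≤ r := ht.trans hr.1
      have hb := hsol.norm_rescaledField_sub_le hF hp hr0 ht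
      have hv := hsol.norm_v_sub_le hF hz hr0 ht
      have habs : |t - r| ≤ δ := by
        rw [abs_le]; constructor <;> linarith [hr.1, hr.2]
      have h1 : ‖rescaledField F p (x t) - rescaledField F p (x r)‖ ≤ ε / 2 := by
        calc _ ≤ (4 * ((p - 1 : ℕ) : ℝ) + 1) * (‖v 0 - z‖ * |t - r|) := by
              refine hb.trans ?_
              gcongr
          _ = ((4 * ((p - 1 : ℕ) : ℝ) + 1) * ‖v 0 - z‖) * |t - r| := by ring
          _ ≤ L * δ := by
              gcongr
              rw [hL]
              linarith
          _ = ε / 2 := by rw [hδ]; field_simp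
      have h2 := norm_sub_norm_le (rescaledField F p (x t)) (rescaledField F p (x r))
      have h3 : ε / 2 ≤ ‖rescaledField F p (x r)‖ := by linarith
      gcongr
  rw [add_sub_cancel_left] at this
  linarith

lemma tendsto_F (hF : IsMonotoneOperator F) (hp : 1 ≤ p)
    (hsol : IsGlobalSolution F p x₀ x v s) {z : H} (hz : F z = 0) :
    Tendsto (fun t => F (x t)) atTop (𝓝 0) := by
  have h := hsol.tendsto_rescaledField hF hp hz
  have := (h.norm.pow (p - 1)).smul h
  rw [smul_zero] at this
  exact this.congr fun t => norm_pow_smul_rescaledField hp (x t)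

lemma norm_x_sub_le (hF : IsMonotoneOperator F) (hsol : IsGlobalSolution F p x₀ x v s)
    {z : H} (hz : F z = 0) {t : ℝ} (ht : 0 ≤ t) : ‖x t - z‖ ≤ 2 * ‖v 0 - z‖ := by
  have e : x t - z = (v t - z) - rescaledField F p (x t) := by
    rw [hsol.v_eq_add ht]; abel
  have h1 := hsol.norm_le hF hz le_rfl ht
  have h2 := hsol.norm_rescaledField_le hF hz ht
  rw [e]
  exact (norm_sub_le _ _).trans (by linarith)

/-- If a whole ball consists of zeros, then the length of the trajectory is controlled by the
decrease of the squared distance to its centre. -/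
lemma norm_v_sub_le_of_closedBall (hF : IsMonotoneOperator F)
    (hsol : IsGlobalSolution F p x₀ x v s) {z : H} {r : ℝ} (hr : 0 ≤ r)
    (hball : ∀ y ∈ Metric.closedBall z r, F y = 0) {t₁ t₂ : ℝ} (h₁ : 0 ≤ t₁) (h₁₂ : t₁ ≤ t₂) :
    2 * r * ‖v t₂ - v t₁‖ ≤ ‖v t₁ - z‖ ^ 2 - ‖v t₂ - z‖ ^ 2 := by
  set w : H := v t₂ - v t₁ with hw
  -- Fejér monotonicity is applied at the zero of the ball lying farthest from `z` in the direction
  -- opposite to the increment `w`; expanding the squares yields `2 r ‖w‖`.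
  set d : H := (-(r / ‖w‖)) • w with hd
  have hdr : ‖d‖ ≤ r := by
    rcases eq_or_ne w 0 with h0 | h0
    · rw [hd, h0, smul_zero, norm_zero]; exact hr
    · rw [hd, norm_smul, norm_neg, Real.norm_of_nonneg (by positivity),
        div_mul_cancel₀ _ (norm_ne_zero_iff.2 h0)]
  have h := hsol.normSq_le hF (hball (z + d) (by simpa using hdr)) h₁ h₁₂
  rw [← sub_sub, ← sub_sub, norm_sub_sq_real, norm_sub_sq_real (v t₁ - z)] at h
  have e : inner ℝ (v t₂ - z) d - inner ℝ (v t₁ - z) d = -(r * ‖w‖) := by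
    rw [← inner_sub_left, sub_sub_sub_cancel_right, ← hw, hd, real_inner_smul_right,
      real_inner_self_eq_norm_sq]
    rcases eq_or_ne w 0 with h0 | h0
    · simp [h0]
    · have := norm_ne_zero_iff.2 h0
      field_simp
  linarith

/-- The squared distance to the centre of a ball of zeros converges, so it is Cauchy, and its
oscillation dominates that of `v`. -/
lemma exists_tendsto_v_of_interior_nonempty [CompleteSpace H] (hF : IsMonotoneOperator F)
    (hsol : IsGlobalSolution F p x₀ x v s) (hint : (interior {z : H | F z = 0}).Nonempty) :
    ∃ b, Tendsto v atTop (𝓝 b) := by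
  obtain ⟨z, hz⟩ := hint
  obtain ⟨r, hr, hball⟩ := Metric.nhds_basis_closedBall.mem_iff.1 (mem_interior_iff_mem_nhds.1 hz)
  have hz0 : z ∈ {z : H | F z = 0} := interior_subset hz
  obtain ⟨c, hc⟩ := hsol.exists_tendsto_norm hF hz0
  refine cauchy_map_iff_exists_tendsto.1 ?_
  have hE := (hc.pow 2).cauchy_map
  rw [Metric.cauchy_iff] at hE ⊢
  refine ⟨inferInstance, fun ε hε => ?_⟩
  obtain ⟨T, hT, hTd⟩ := hE.2 (2 * r * ε) (by positivity)
  refine ⟨v '' ((fun t => ‖v t - z‖ ^ 2) ⁻¹' T ∩ Set.Ici 0),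
    image_mem_map (inter_mem hT (Ici_mem_atTop 0)), ?_⟩
  have key : ∀ a b : ℝ, 0 ≤ a → a ≤ b → ‖v a - z‖ ^ 2 ∈ T → ‖v b - z‖ ^ 2 ∈ T →
      dist (v b) (v a) < ε := by
    intro a b ha hab haT hbT
    have h1 := hsol.norm_v_sub_le_of_closedBall hF hr.le (fun y hy => hball hy) ha hab
    have h2 := (le_abs_self _).trans_lt (hTd _ haT _ hbT)
    rw [dist_eq_norm]
    exact lt_of_mul_lt_mul_left (h1.trans_lt h2) (by positivity)
  rintro _ ⟨a, ⟨haT, ha⟩, rfl⟩ _ ⟨b, ⟨hbT, hb⟩, rfl⟩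
  rcases le_total a b with hab | hab
  · rw [dist_comm]; exact key a b ha hab haT hbT
  · exact key b a hb hab hbT haT

end IsGlobalSolution

/-! ### Weak and strong convergence. -/

theorem theorem2 {H : Type*} [NormedAddCommGroup H] [InnerProductSpace ℝ H] [CompleteSpace H]
    (F : H → H) (hF_cont : Continuous F) (hF_mono : IsMonotoneOperator F)
    (hF_zero : ∃ z : H, F z = 0)
    (p : ℕ) (hp : 1 ≤ p) (x₀ : H) (x v s : ℝ → H)
    (hsol : IsGlobalSolution F p x₀ x v s) :
    ∃ xbar : H, F xbar = 0 ∧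
      WeaklyConvergesTo x xbar ∧ WeaklyConvergesTo v xbar ∧
      (((∃ f : H → ℝ, ConvexOn ℝ Set.univ f ∧ Differentiable ℝ f ∧ IsInfCompact f ∧
            F = gradient f) ∨
          (interior {z : H | F z = 0}).Nonempty) →
        Tendsto x atTop (𝓝 xbar) ∧ Tendsto v atTop (𝓝 xbar)) := by
  obtain ⟨z, hz⟩ := hF_zero
  have hG := hsol.tendsto_rescaledField hF_mono hp hz
  have hFx := hsol.tendsto_F hF_mono hp hz
  have hv : ∀ᶠ t in atTop, v t = x t + rescaledField F p (x t) := by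
    filter_upwards [eventually_ge_atTop 0] with t ht using hsol.v_eq_add ht
  have hinner : ∀ {l : Filter ℝ}, l ≤ atTop → ∀ {w y : H},
      Tendsto (fun t => inner ℝ (v t) y) l (𝓝 (inner ℝ w y)) →
      Tendsto (fun t => inner ℝ (x t) y) l (𝓝 (inner ℝ w y)) := by
    intro l hl w y h
    have h1 := h.sub ((hG.mono_left hl).inner (tendsto_const_nhds (x := y)))
    rw [inner_zero_left, sub_zero] at h1
    refine h1.congr' ?_
    filter_upwards [hl hv] with t ht
    rw [ht, inner_add_left, add_sub_cancel_right]
  have hxbdd : ∀ᶠ t in atTop, ‖x t‖ ≤ 2 * ‖v 0 - z‖ + ‖z‖ := by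
    filter_upwards [eventually_ge_atTop 0] with t ht
    have h1 := hsol.norm_x_sub_le hF_mono hz ht
    have h2 := norm_add_le (x t - z) z
    rw [sub_add_cancel] at h2
    linarith
  obtain ⟨w, hw, hvw⟩ := exists_forall_tendsto_inner_of_opial (l := atTop) (u := v)
    (S := {z | F z = 0}) ⟨z, hz⟩ (fun y hy => hsol.exists_tendsto_norm hF_mono hy)
    fun U hU w hw => hF_mono.eq_zero_of_tendsto hF_cont (hU hxbdd) (hFx.mono_left hU)
      fun y => hinner hU (hw y)
  have hxw : ∀ y, Tendsto (fun t => inner ℝ (x t) y) atTop (𝓝 (inner ℝ w y)) :=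
    fun y => hinner le_rfl (hvw y)
  refine ⟨w, hw, tendsto_toWeakSpace_of_tendsto_inner hxw,
    tendsto_toWeakSpace_of_tendsto_inner hvw, ?_⟩
  rintro (⟨f, hconv, hdiff, hcomp, rfl⟩ | hint)
  -- Since `x` is bounded and the gradient along it tends to `0`, the gradient inequality makes the
  -- excess of `f (x t)` over `f z` eventually at most `1`.
  · have hmem : ∀ᶠ t in atTop, x t ∈ {y | f y ≤ f z + 1} := by
      have hlim : Tendsto (fun t => ‖gradient f (x t)‖ * (2 * ‖v 0 - z‖)) atTop (𝓝 0) := by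
        simpa using hFx.norm.mul_const (2 * ‖v 0 - z‖)
      filter_upwards [eventually_ge_atTop 0, hlim.eventually_le_const one_pos] with t ht hle
      have h1 := hconv.le_add_inner_gradient hdiff (x t) z
      have h2 := real_inner_le_norm (gradient f (x t)) (x t - z)
      have h3 := mul_le_mul_of_nonneg_left (hsol.norm_x_sub_le hF_mono hz ht)
        (norm_nonneg (gradient f (x t)))
      exact h1.trans (by linarith)
    have hx := tendsto_of_tendsto_inner_of_isCompact (hcomp (f z + 1)) hmem hxw
    refine ⟨hx, ?_⟩
    have := hx.add hG
    rw [add_zero] at this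
    exact this.congr' (hv.mono fun t ht => ht.symm)
  · obtain ⟨b, hb⟩ := hsol.exists_tendsto_v_of_interior_nonempty hF_mono hint
    obtain rfl := eq_of_tendsto_of_tendsto_inner hb hvw
    refine ⟨?_, hb⟩
    have := hb.sub hG
    rw [sub_zero] at this
    refine this.congr' (hv.mono fun t ht => ?_)
    rw [ht, add_sub_cancel_right]
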